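/- Let $T\ge 1$, let $\mathcal X_1,\dots,\mathcal X_T$ be Polish spaces with their Borel $\sigma$-algebras, and let $\mathcal X=\prod_{t=1}^T\mathcal X_t$ with the product topology. For $x=(x_1,\dots,x_T)\in\mathcal X$ write $x_{1:t}=(x_1,\dots,x_t)$. Let $\mu,\nu$ be Borel probability measures on $\mathcal X$. A Borel probability measure $\pi$ on $\mathcal X\times\mathcal X$ is a *bicausal coupling* of $\mu$ and $\nu$ if its first and second marginals are $\mu$ and $\nu$ and, for $(X,Y)\sim\pi$ and every $t\in\{1,\dots,T-1\}$, under $\pi$, $Y_{1:t}$ is conditionally independent of $X$ given $X_{1:t}$, and $X_{1:t}$ is conditionally independent of $Y$ given $Y_{1:t}$. Let $\mathrm{Cpl}_{\mathrm{bc}}(\mu,\nu)$ be the set of bicausal couplings. For Borel measurable $\varphi:\mathcal X\to[0,\infty)$ define the adapted weighted total variation $$\mathrm{ATV}_\varphi(\mu,\nu)=\inf_{\pi\in\mathrm{Cpl}_{\mathrm{bc}}(\mu,\nu)}\int_{\mathcal X\times\mathcal X}\bigl(\varphi(x)+\varphi(y)\bigr)\mathbf 1_{\{x\ne y\}}\,\pi(dx,dy)\in[0,\infty],$$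 and let $H(\nu|\mu)=\int\log\frac{d\nu}{d\mu}\,d\nu$ if $\nu\ll\mu$ and $H(\nu|\mu)=+\infty$ otherwise. **Theorem.** For all Borel probability measures $\mu,\nu$ on $\mathcal X$ and every Borel measurable $\varphi:\mathcal X\to[0,\infty)$, $$\mathrm{ATV}_\varphi(\mu,\nu)\le(2\sqrt T+1)\left(1+\log\int_{\mathcal X}e^{\varphi(x)^2}\,\mu(dx)\right)^{1/2}\sqrt{2H(\nu|\mu)},$$ where both sides take values in $[0,\infty]$, with $\log\infty=\infty$ and $0\cdot\infty=0$. -/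

import Mathlib

open MeasureTheory ProbabilityTheory InformationTheory
open scoped ENNReal NNReal

namespace AdaptedTransport

universe u

/-- The first `t` coordinates of a path `x` with `T` time steps. Time is indexed by `Fin T`, so the
coordinates kept are those whose index is `0, …, t - 1`. -/
def initSegment {T : ℕ} {X : Fin T → Type u} (t : ℕ) (x : ∀ i, X i) :
    ∀ i : {i : Fin T // (i : ℕ) < t}, X i :=
  fun i => x i

lemma measurable_initSegment {T : ℕ} {X : Fin T → Type u} [∀ i, MeasurableSpace (X i)] (t : ℕ) :
    Measurable (initSegment (X := X) t) :=
  measurable_pi_lambda _ fun i => measurable_pi_apply i.1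

/-- `π` is a bicausal coupling of `μ` and `ν`: it has marginals `μ` and `ν`, and for `(X, Y) ∼ π`
and `1 ≤ t ≤ T - 1`, the segment `Y_{1:t}` is conditionally independent of the whole path `X` given
`X_{1:t}`, and the segment `X_{1:t}` is conditionally independent of the whole path `Y` given
`Y_{1:t}`. -/
structure IsBicausalCoupling {T : ℕ} {X : Fin T → Type u} [∀ i, MeasurableSpace (X i)]
    [∀ i, StandardBorelSpace (X i)]
    (π : Measure ((∀ i, X i) × (∀ i, X i))) [IsProbabilityMeasure π]
    (μ ν : Measure (∀ i, X i)) : Prop where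
  map_fst : π.map Prod.fst = μ
  map_snd : π.map Prod.snd = ν
  causal : ∀ t : ℕ, 1 ≤ t → t < T →
    (fun p : (∀ i, X i) × (∀ i, X i) => initSegment (X := X) t p.2)
      ⟂ᵢ[fun p : (∀ i, X i) × (∀ i, X i) => initSegment (X := X) t p.1,
        (measurable_initSegment t).comp measurable_fst; π]
    (fun p : (∀ i, X i) × (∀ i, X i) => p.1)
  anticausal : ∀ t : ℕ, 1 ≤ t → t < T →
    (fun p : (∀ i, X i) × (∀ i, X i) => initSegment (X := X) t p.1)
      ⟂ᵢ[fun p : (∀ i, X i) × (∀ i, X i) => initSegment (X := X) t p.2,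
        (measurable_initSegment t).comp measurable_snd; π]
    (fun p : (∀ i, X i) × (∀ i, X i) => p.2)

/-- The adapted weighted total variation: the infimum over all bicausal couplings `π` of
`∫ (φ x + φ y) 1_{x ≠ y} π(dx, dy)`, as an extended nonnegative number. -/
noncomputable def adaptedTV {T : ℕ} {X : Fin T → Type u} [∀ i, MeasurableSpace (X i)]
    [∀ i, StandardBorelSpace (X i)]
    (φ : (∀ i, X i) → ℝ≥0) (μ ν : Measure (∀ i, X i)) : ℝ≥0∞ :=
  ⨅ (π : ProbabilityMeasure ((∀ i, X i) × (∀ i, X i)))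
    (_ : IsBicausalCoupling (π : Measure ((∀ i, X i) × (∀ i, X i))) μ ν),
    ∫⁻ p, {p : (∀ i, X i) × (∀ i, X i) | p.1 ≠ p.2}.indicator
      (fun p => (φ p.1 : ℝ≥0∞) + (φ p.2 : ℝ≥0∞)) p ∂(π : Measure ((∀ i, X i) × (∀ i, X i)))

end AdaptedTransport

/-!
Let `r t` be the likelihood ratio of `ν` to `μ` in the transition from time `t` to time `t + 1`. Of
the mass of `μ` at `x` a fraction `∏ min(1, r t x)` stays on the diagonal, of the mass of `ν` at `y`
a fraction `∏ min(1, 1 / r t y)`. The masses that `μ` and `ν` lose in step `t` agree on the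
information available at time `t`; gluing them conditionally independently given that information
gives a bicausal coupling, whose cost is `∫ φ (1 - u) dμ + ∫ φ (1 - v) dν` for the surviving
fractions `u` and `v`. The squares of the losses in one step are integrated to at most twice the
relative entropy of the corresponding transition. By the chain rule these entropies add up to at
most `H(ν | μ)`, so that `∫ (1 - u)² dμ` and `∫ (1 - v)² dν` are at most `2 T H(ν | μ)`.
Cauchy-Schwarz and the Gibbs variational principle, which bounds `∫ φ² dν` by
`H(ν | μ) + log ∫ exp (φ²) dμ`, conclude.
-/

namespace AdaptedTransport

section Gluing

variable {E : Type*} {m mE : MeasurableSpace E}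

/-- The measure `π` on `E × E'` has an `m`-measurable section density with respect to `μ` over the
events of `m'`. If `π` is the law of `(X, Y)` and `μ` the law of `X`, then it says that the
conditional probability of `{Y ∈ B}` given `X` is a function of the information in `m`, for every
`B` in `m'`. -/
def HasSectionDensity {E E' : Type*} (m : MeasurableSpace E) (m' : MeasurableSpace E')
    {_ : MeasurableSpace E} {_ : MeasurableSpace E'} (μ : Measure E) (π : Measure (E × E')) :
    Prop :=
  ∀ B, MeasurableSet[m'] B → ∃ g : E → ℝ≥0∞, Measurable[m] g ∧
    ∀ A, MeasurableSet A → π (A ×ˢ B) = ∫⁻ x in A, g x ∂μ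

/-- `ρ` has first marginal `α`, the second coordinate is conditionally independent of the first one
given the `σ`-algebra `m`, and the two coordinates agree on `m`. -/
structure IsGluedAlong (m : MeasurableSpace E) {mE : MeasurableSpace E}
    (α : Measure E) (ρ : Measure (E × E)) : Prop where
  hasSectionDensity : HasSectionDensity m mE α ρ
  prod_eq : ∀ {A B}, MeasurableSet A → MeasurableSet[m] B → ρ (A ×ˢ B) = α (A ∩ B)

lemma IsGluedAlong.map_fst {α : Measure E} {ρ : Measure (E × E)} (h : IsGluedAlong m α ρ) :
    ρ.map Prod.fst = α := by
  ext A hA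
  rw [Measure.map_apply measurable_fst hA, ← Set.prod_univ, h.prod_eq hA .univ, Set.inter_univ]

lemma measurable_diag_of_le (hm : m ≤ mE) :
    @Measurable E (E × E) mE (m.prod mE) Function.diag :=
  (measurable_id'' hm).prodMk measurable_id

variable [StandardBorelSpace E] {α β : Measure E} [IsFiniteMeasure α] [IsFiniteMeasure β]

lemma trim_restrict_eq_withDensity_condExpKernel (hm : m ≤ mE) {A : Set E}
    (hA : MeasurableSet A) :
    (α.restrict A).trim hm = (α.trim hm).withDensity fun x => condExpKernel α m x A := by
  refine @Measure.ext _ m _ _ fun B hB => ?_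
  rw [trim_measurableSet_eq hm hB, Measure.restrict_apply (hm _ hB), withDensity_apply _ hB,
    ← Measure.compProd_apply_prod hB hA, compProd_trim_condExpKernel,
    @Measure.map_apply _ _ _ (m.prod mE) _ _ (measurable_diag_of_le hm) _ (hB.prod hA)]
  rfl

lemma lintegral_condExpKernel_mul (hm : m ≤ mE) {A : Set E} (hA : MeasurableSet A) {g : E → ℝ≥0∞}
    (hg : Measurable[m] g) :
    ∫⁻ x, condExpKernel α m x A * g x ∂α.trim hm = ∫⁻ x in A, g x ∂α := by
  rw [← lintegral_trim hm hg, trim_restrict_eq_withDensity_condExpKernel hm hA,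
    lintegral_withDensity_eq_lintegral_mul _ (measurable_condExpKernel hA) hg]
  rfl

/-- The gluing of `α` and `β` along `m`: a point is drawn from the restriction of `α` to `m`, and
given it the two coordinates are drawn independently from the conditional laws of `α` and `β`. It
is meaningful when `α` and `β` agree on `m`. -/
noncomputable def condIndepGluing (hm : m ≤ mE) (α β : Measure E) [IsFiniteMeasure α]
    [IsFiniteMeasure β] : Measure (E × E) :=
  (condExpKernel α m ×ₖ condExpKernel β m) ∘ₘ α.trim hm

lemma condIndepGluing_prod (hm : m ≤ mE) {A B : Set E} (hA : MeasurableSet A)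
    (hB : MeasurableSet B) :
    condIndepGluing hm α β (A ×ˢ B)
      = ∫⁻ x, condExpKernel α m x A * condExpKernel β m x B ∂α.trim hm := by
  rw [condIndepGluing, Measure.bind_apply (hA.prod hB) (Kernel.aemeasurable _)]
  simp_rw [Kernel.prod_apply_prod]

lemma map_swap_condIndepGluing (hm : m ≤ mE) (h : α.trim hm = β.trim hm) :
    (condIndepGluing hm α β).map Prod.swap = condIndepGluing hm β α := by
  rw [condIndepGluing, condIndepGluing, Measure.map_comp _ _ measurable_swap, ← h,
    Kernel.map_prod_swap]

lemma isGluedAlong_condIndepGluing (hm : m ≤ mE) (h : α.trim hm = β.trim hm) :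
    IsGluedAlong m α (condIndepGluing hm α β) where
  hasSectionDensity B hB := ⟨fun x => condExpKernel β m x B, measurable_condExpKernel hB,
    fun A hA => by
      rw [condIndepGluing_prod hm hA hB,
        lintegral_condExpKernel_mul hm hA (measurable_condExpKernel hB)]⟩
  prod_eq {A B} hA hB := by
    have hκ : Measurable[m] fun x => condExpKernel α m x A := measurable_condExpKernel hA
    calc condIndepGluing hm α β (A ×ˢ B)
        = ∫⁻ x, condExpKernel β m x B * condExpKernel α m x A ∂β.trim hm := by
          rw [condIndepGluing_prod hm hA (hm _ hB), h]
          simp_rw [mul_comm]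
      _ = ∫⁻ x in B, condExpKernel α m x A ∂α.trim hm := by
          rw [lintegral_condExpKernel_mul hm (hm _ hB) hκ, h, setLIntegral_trim hm hκ hB]
      _ = α (A ∩ B) := by
          rw [← withDensity_apply _ hB, ← trim_restrict_eq_withDensity_condExpKernel hm hA,
            trim_measurableSet_eq hm hB, Measure.restrict_apply (hm _ hB), Set.inter_comm]

end Gluing

section CondIndep

variable {Ω : Type*} {m m₀ m₁ mΩ : MeasurableSpace Ω} {P : Measure Ω} [IsFiniteMeasure P]

lemma condExp_indicator_ae_eq_toReal (hm : m ≤ mΩ) {S : Set Ω} (hS : MeasurableSet S)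
    {G : Ω → ℝ≥0∞} (hG : Measurable[m] G)
    (h : ∀ s, MeasurableSet[m] s → ∫⁻ ω in s, G ω ∂P = P (s ∩ S)) :
    P⟦S | m⟧ =ᵐ[P] fun ω => (G ω).toReal := by
  have hS1 : Measurable (S.indicator (1 : Ω → ℝ≥0∞)) := measurable_one.indicator hS
  have hGcond : G =ᵐ[P] P⁻[S.indicator 1 | m] := by
    refine ae_eq_condLExp hm P _ hG fun s hs => ?_
    rw [h s hs, lintegral_indicator_one hS, Measure.restrict_apply hS, Set.inter_comm]
  have hSreal : (fun ω => (S.indicator (1 : Ω → ℝ≥0∞) ω).toReal) = S.indicator fun _ => 1 := by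
    ext ω
    by_cases hω : ω ∈ S <;> simp [hω]
  have hcond := toReal_condLExp (μ := P) m hS1.aemeasurable
    (by simp [lintegral_indicator_one hS])
  rw [hSreal] at hcond
  filter_upwards [hGcond, hcond] with ω h₁ h₂
  rw [← h₂, h₁]

lemma condExp_inter_ae_eq_mul (h₀₁ : m₀ ≤ m₁) (h₁ : m₁ ≤ mΩ) {s S : Set Ω}
    (hs : MeasurableSet[m₁] s) (hS : MeasurableSet S) (h : P⟦S | m₁⟧ =ᵐ[P] P⟦S | m₀⟧) :
    P⟦s ∩ S | m₀⟧ =ᵐ[P] P⟦s | m₀⟧ * P⟦S | m₀⟧ := by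
  have hs' : MeasurableSet s := h₁ _ hs
  have hpull : P⟦s ∩ S | m₁⟧ =ᵐ[P] (s.indicator fun _ => (1 : ℝ)) * P⟦S | m₀⟧ := by
    rw [← Set.indicator_indicator]
    refine (condExp_indicator ((integrable_const _).indicator hS) hs).trans ?_
    filter_upwards [h] with ω hω
    by_cases hωs : ω ∈ s <;> simp [hωs, hω]
  have hint : Integrable ((s.indicator fun _ => (1 : ℝ)) * P⟦S | m₀⟧) P := by
    refine (integrable_condExp.indicator hs' (f := P⟦S | m₀⟧)).congr (.of_forall fun ω => ?_)
    by_cases hωs : ω ∈ s <;> simp [hωs]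
  calc P⟦s ∩ S | m₀⟧ =ᵐ[P] P[P⟦s ∩ S | m₁⟧ | m₀] := (condExp_condExp_of_le h₀₁ h₁).symm
    _ =ᵐ[P] P[(s.indicator fun _ => (1 : ℝ)) * P⟦S | m₀⟧ | m₀] := condExp_congr_ae hpull
    _ =ᵐ[P] P⟦s | m₀⟧ * P⟦S | m₀⟧ := condExp_mul_of_stronglyMeasurable_right
        stronglyMeasurable_condExp hint ((integrable_const _).indicator hs')

lemma condIndepFun_of_hasSectionDensity [StandardBorelSpace Ω] {E E' γ γ' : Type*}
    [MeasurableSpace E] [MeasurableSpace E'] [MeasurableSpace γ] [MeasurableSpace γ']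
    {X : Ω → E} {Y : Ω → E'} (hX : Measurable X) (hY : Measurable Y)
    {f : E → γ} (hf : Measurable f) {f' : E' → γ'} (hf' : Measurable f')
    (h : HasSectionDensity (.comap f inferInstance) (.comap f' inferInstance)
      (P.map X) (P.map fun ω => (X ω, Y ω))) :
    (fun ω => f' (Y ω)) ⟂ᵢ[fun ω => f (X ω), hf.comp hX; P] X := by
  have h₀₁ : MeasurableSpace.comap (fun ω => f (X ω)) inferInstance
      ≤ MeasurableSpace.comap X inferInstance := by
    rw [← Function.comp_def f X, ← MeasurableSpace.comap_comp]
    exact MeasurableSpace.comap_mono hf.comap_le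
  refine (condIndepFun_iff_condExp_inter_preimage_eq_mul hX (hf'.comp hY)).2
    (fun A B hA hB => ?_) |>.symm
  have hS : MeasurableSet (Y ⁻¹' (f' ⁻¹' B)) := hY (hf' hB)
  obtain ⟨g, hg, hgA⟩ := h _ ⟨B, hB, rfl⟩
  have hgX : Measurable[MeasurableSpace.comap (fun ω => f (X ω)) inferInstance] (g ∘ X) := by
    obtain ⟨g', hg', rfl⟩ := hg.exists_eq_measurable_comp
    exact hg'.comp (comap_measurable fun ω => f (X ω))
  have hset : ∀ s, MeasurableSet[MeasurableSpace.comap X inferInstance] s →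
      ∫⁻ ω in s, (g ∘ X) ω ∂P = P (s ∩ Y ⁻¹' (f' ⁻¹' B)) := by
    rintro _ ⟨A', hA', rfl⟩
    have hprod := hgA A' hA'
    rw [Measure.map_apply (hX.prodMk hY) (hA'.prod (hf' hB)),
      setLIntegral_map hA' (hg.mono hf.comap_le le_rfl) hX] at hprod
    exact hprod.symm
  have h₁ := condExp_indicator_ae_eq_toReal hX.comap_le hS (hgX.mono h₀₁ le_rfl) hset
  have h₀ := condExp_indicator_ae_eq_toReal (hf.comp hX).comap_le hS hgX
    fun s hs => hset s (h₀₁ s hs)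
  exact condExp_inter_ae_eq_mul h₀₁ hX.comap_le ⟨A, hA, rfl⟩ hS (h₁.trans h₀.symm)

end CondIndep

section SplitCoupling

variable {E : Type*} {mE : MeasurableSpace E}

lemma measurableSet_fst_ne_snd [MeasurableEq E] : MeasurableSet {p : E × E | p.1 ≠ p.2} :=
  measurableSet_diagonal.compl

variable {μ ν : Measure E} {ℱ : Filtration ℕ mE}
  {u v : ℕ → E → ℝ≥0} {ρ : ℕ → Measure (E × E)} {T : ℕ}

/-- `π` has first marginal `μ` and, for `(X, Y) ∼ π` and every time `s ≤ T`, the events of `ℱ s` for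
`Y` have a conditional probability given `X` which depends only on the information `ℱ s` about
`X`. -/
structure IsCausalAlong (ℱ : Filtration ℕ mE) (T : ℕ) (μ : Measure E) (π : Measure (E × E)) :
    Prop where
  map_fst : π.map Prod.fst = μ
  hasSectionDensity : ∀ s ≤ T, HasSectionDensity (ℱ s) (ℱ s) μ π

/-- An adapted process that starts at `1` and decreases in time. Its value `u t x` is the fraction
of the mass at `x` that is kept on the diagonal up to time `t`. -/
structure IsSurvivalProcess (ℱ : Filtration ℕ mE) (u : ℕ → E → ℝ≥0) : Prop where
  adapted : Adapted ℱ u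
  antitone : ∀ x, Antitone fun t => u t x
  zero_eq_one : ∀ x, u 0 x = 1

namespace IsSurvivalProcess

lemma measurable (hu : IsSurvivalProcess ℱ u) (t : ℕ) : Measurable (u t) :=
  (hu.adapted t).mono (ℱ.le t) le_rfl

lemma le_one (hu : IsSurvivalProcess ℱ u) (t : ℕ) (x : E) : u t x ≤ 1 :=
  hu.zero_eq_one x ▸ hu.antitone x t.zero_le

lemma measurable_loss (hu : IsSurvivalProcess ℱ u) (t : ℕ) :
    Measurable[ℱ (t + 1)] fun x => ((u t x - u (t + 1) x : ℝ≥0) : ℝ≥0∞) :=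
  (((hu.adapted t).mono (ℱ.mono t.le_succ) le_rfl).sub (hu.adapted (t + 1))).coe_nnreal_ennreal

lemma sum_Ico_loss_add (hu : IsSurvivalProcess ℱ u) (x : E) {s : ℕ} (h : s ≤ T) :
    ∑ t ∈ Finset.Ico s T, (u t x - u (t + 1) x) + u T x = u s x := by
  induction T, h using Nat.le_induction with
  | base => simp
  | succ T h ih =>
    rw [Finset.sum_Ico_succ_top h, add_assoc, tsub_add_cancel_of_le (hu.antitone x T.le_succ), ih]

lemma sum_range_loss (hu : IsSurvivalProcess ℱ u) (x : E) (T : ℕ) :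
    ∑ t ∈ Finset.range T, (u t x - u (t + 1) x) = 1 - u T x := by
  rw [← hu.zero_eq_one x, ← hu.sum_Ico_loss_add x T.zero_le, Finset.range_eq_Ico,
    add_tsub_cancel_right]

end IsSurvivalProcess

/-- The part of `μ` that is lost when the surviving fraction decreases from `u t` to
`u (t + 1)`. -/
noncomputable def lossMeasure (μ : Measure E) (u : ℕ → E → ℝ≥0) (t : ℕ) : Measure E :=
  μ.withDensity fun x => (u t x - u (t + 1) x : ℝ≥0)

lemma lossMeasure_le (hu : IsSurvivalProcess ℱ u) (t : ℕ) : lossMeasure μ u t ≤ μ := by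
  rw [lossMeasure]
  conv_rhs => rw [← withDensity_one (μ := μ)]
  exact withDensity_mono (.of_forall fun x =>
    ENNReal.coe_le_coe.2 (tsub_le_self.trans (hu.le_one t x)))

lemma lossMeasure_add_setLIntegral (hu : IsSurvivalProcess ℱ u) (t : ℕ) {A : Set E}
    (hA : MeasurableSet A) :
    lossMeasure μ u t A + ∫⁻ x in A, u (t + 1) x ∂μ = ∫⁻ x in A, u t x ∂μ := by
  rw [lossMeasure, withDensity_apply _ hA,
    ← lintegral_add_right _ (hu.measurable (t + 1)).coe_nnreal_ennreal]
  exact lintegral_congr fun x => by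
    exact_mod_cast tsub_add_cancel_of_le (hu.antitone x t.le_succ)

lemma trim_lossMeasure_eq [IsFiniteMeasure μ] (hu : IsSurvivalProcess ℱ u)
    (hv : IsSurvivalProcess ℱ v)
    (huv : ∀ t A, MeasurableSet[ℱ t] A → ∫⁻ x in A, u t x ∂μ = ∫⁻ x in A, v t x ∂ν) (t : ℕ) :
    (lossMeasure μ u t).trim (ℱ.le t) = (lossMeasure ν v t).trim (ℱ.le t) := by
  refine @Measure.ext _ (ℱ t) _ _ fun A hA => ?_
  have hA' : MeasurableSet A := ℱ.le t _ hA
  have hfin : ∫⁻ x in A, u (t + 1) x ∂μ ≠ ∞ := by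
    refine ne_top_of_le_ne_top (measure_ne_top μ A) ?_
    rw [← setLIntegral_one]
    exact lintegral_mono fun x => ENNReal.coe_le_coe.2 (hu.le_one (t + 1) x)
  rw [trim_measurableSet_eq _ hA, trim_measurableSet_eq _ hA, ← ENNReal.add_left_inj hfin,
    lossMeasure_add_setLIntegral hu t hA', huv t A hA, huv (t + 1) A (ℱ.mono t.le_succ _ hA),
    lossMeasure_add_setLIntegral hv t hA']

/-- The measure on pairs that keeps the surviving part `u T • μ` on the diagonal and adds the gluing
`ρ t` of the mass lost at each step `t < T`. -/
noncomputable def splitCoupling (μ : Measure E) (u : ℕ → E → ℝ≥0) (T : ℕ)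
    (ρ : ℕ → Measure (E × E)) : Measure (E × E) :=
  ∑ t ∈ Finset.range T, ρ t + (μ.withDensity fun x => (u T x : ℝ≥0∞)).map Function.diag

lemma map_swap_splitCoupling
    (h : (μ.withDensity fun x => (u T x : ℝ≥0∞)) = ν.withDensity fun x => (v T x : ℝ≥0∞)) :
    (splitCoupling μ u T ρ).map Prod.swap = splitCoupling ν v T fun t => (ρ t).map Prod.swap := by
  rw [splitCoupling, splitCoupling, h, Measure.map_add _ _ measurable_swap,
    Measure.map_map measurable_swap measurable_diag]
  simp_rw [← Measure.mapₗ_apply_of_measurable measurable_swap, map_sum]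
  rfl

lemma splitCoupling_prod_eq (hu : IsSurvivalProcess ℱ u)
    (hρ : ∀ t, IsGluedAlong (ℱ t) (lossMeasure μ u t) (ρ t)) {s : ℕ} (hs : s ≤ T) {A B : Set E}
    (hA : MeasurableSet A) (hB : MeasurableSet[ℱ s] B) :
    splitCoupling μ u T ρ (A ×ˢ B)
      = ∑ t ∈ Finset.range s, ρ t (A ×ˢ B) + ∫⁻ x in A ∩ B, u s x ∂μ := by
  have hB' : MeasurableSet B := ℱ.le s _ hB
  have hdiag : (μ.withDensity fun x => (u T x : ℝ≥0∞)).map Function.diag (A ×ˢ B)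
      = ∫⁻ x in A ∩ B, u T x ∂μ := by
    rw [Measure.map_apply measurable_diag (hA.prod hB'),
      ← withDensity_apply _ (hA.inter hB')]
    rfl
  have hlate : ∀ t ∈ Finset.Ico s T, ρ t (A ×ˢ B)
      = ∫⁻ x in A ∩ B, (u t x - u (t + 1) x : ℝ≥0) ∂μ := by
    intro t ht
    rw [(hρ t).prod_eq hA (ℱ.mono (Finset.mem_Ico.1 ht).1 _ hB), lossMeasure,
      withDensity_apply _ (hA.inter hB')]
  rw [splitCoupling, Measure.add_apply, Measure.finsetSum_apply, hdiag,
    ← Finset.sum_range_add_sum_Ico _ hs, Finset.sum_congr rfl hlate, add_assoc,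
    ← lintegral_finsetSum _ fun t _ => (hu.measurable_loss t).mono (ℱ.le _) le_rfl,
    ← lintegral_add_right _ (hu.measurable T).coe_nnreal_ennreal]
  congr 1
  exact lintegral_congr fun x => by exact_mod_cast hu.sum_Ico_loss_add x hs

lemma hasSectionDensity_splitCoupling (hu : IsSurvivalProcess ℱ u)
    (hρ : ∀ t, IsGluedAlong (ℱ t) (lossMeasure μ u t) (ρ t)) {s : ℕ} (hs : s ≤ T) :
    HasSectionDensity (ℱ s) (ℱ s) μ (splitCoupling μ u T ρ) := by
  intro B hB
  choose g hg hgA using fun t => (hρ t).hasSectionDensity B (ℱ.le s _ hB)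
  let w : ℕ → E → ℝ≥0∞ := fun t x => (u t x - u (t + 1) x : ℝ≥0) * g t x
  have hw : ∀ t, Measurable[ℱ (t + 1)] (w t) := fun t =>
    (hu.measurable_loss t).mul ((hg t).mono (ℱ.mono t.le_succ) le_rfl)
  have hρw : ∀ t {A}, MeasurableSet A → ρ t (A ×ˢ B) = ∫⁻ x in A, w t x ∂μ := by
    intro t A hA
    rw [hgA t A hA, lossMeasure, restrict_withDensity hA,
      lintegral_withDensity_eq_lintegral_mul _ ((hu.measurable_loss t).mono (ℱ.le _) le_rfl)
        ((hg t).mono (ℱ.le t) le_rfl)]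
    rfl
  have hkept : Measurable[ℱ s] (B.indicator fun x => (u s x : ℝ≥0∞)) :=
    Measurable.indicator (hu.adapted s).coe_nnreal_ennreal hB
  refine ⟨fun x => ∑ t ∈ Finset.range s, w t x + B.indicator (fun x => (u s x : ℝ≥0∞)) x,
    (Finset.measurable_fun_sum _ fun t ht =>
      (hw t).mono (ℱ.mono (Finset.mem_range.1 ht)) le_rfl).add hkept, fun A hA => ?_⟩
  rw [splitCoupling_prod_eq hu hρ hs hA hB,
    lintegral_add_right _ (hkept.mono (ℱ.le s) le_rfl),
    lintegral_finsetSum _ fun t _ => (hw t).mono (ℱ.le _) le_rfl,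
    setLIntegral_indicator (ℱ.le s _ hB), Set.inter_comm B A]
  simp_rw [hρw _ hA]

lemma isCausalAlong_splitCoupling (hu : IsSurvivalProcess ℱ u)
    (hρ : ∀ t, IsGluedAlong (ℱ t) (lossMeasure μ u t) (ρ t)) :
    IsCausalAlong ℱ T μ (splitCoupling μ u T ρ) where
  map_fst := by
    ext A hA
    rw [Measure.map_apply measurable_fst hA, ← Set.prod_univ,
      splitCoupling_prod_eq hu hρ T.zero_le hA .univ]
    simp [hu.zero_eq_one]
  hasSectionDensity _ hs := hasSectionDensity_splitCoupling hu hρ hs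

lemma setLIntegral_fst_ne_splitCoupling_le [MeasurableEq E] (hu : IsSurvivalProcess ℱ u)
    (hρ : ∀ t, IsGluedAlong (ℱ t) (lossMeasure μ u t) (ρ t)) {φ : E → ℝ≥0∞} (hφ : Measurable φ) :
    ∫⁻ p in {p : E × E | p.1 ≠ p.2}, φ p.1 ∂splitCoupling μ u T ρ
      ≤ ∫⁻ x, φ x * (1 - u T x : ℝ≥0) ∂μ := by
  have hφ₁ : Measurable fun p : E × E => φ p.1 := hφ.comp measurable_fst
  have hloss : ∀ t, Measurable fun x => ((u t x - u (t + 1) x : ℝ≥0) : ℝ≥0∞) := fun t =>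
    (hu.measurable_loss t).mono (ℱ.le _) le_rfl
  have hdiag : ∫⁻ p in {p : E × E | p.1 ≠ p.2}, φ p.1
      ∂(μ.withDensity fun x => (u T x : ℝ≥0∞)).map Function.diag = 0 := by
    rw [setLIntegral_map measurableSet_fst_ne_snd hφ₁ measurable_diag]
    simp [Function.diag]
  have hstep : ∀ t, ∫⁻ p, φ p.1 ∂ρ t = ∫⁻ x, φ x * (u t x - u (t + 1) x : ℝ≥0) ∂μ := by
    intro t
    rw [← lintegral_map hφ measurable_fst, (hρ t).map_fst, lossMeasure,
      lintegral_withDensity_eq_lintegral_mul _ (hloss t) hφ]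
    simp_rw [Pi.mul_apply, mul_comm]
  calc ∫⁻ p in {p : E × E | p.1 ≠ p.2}, φ p.1 ∂splitCoupling μ u T ρ
      ≤ ∑ t ∈ Finset.range T, ∫⁻ p, φ p.1 ∂ρ t := by
        rw [splitCoupling, Measure.restrict_add, lintegral_add_measure, hdiag, add_zero,
          ← lintegral_finsetSum_measure]
        exact setLIntegral_le_lintegral _ _
    _ = ∫⁻ x, φ x * (1 - u T x : ℝ≥0) ∂μ := by
        simp_rw [hstep]
        rw [← lintegral_finsetSum _ fun t _ => hφ.fun_mul (hloss t)]
        exact lintegral_congr fun x => by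
          rw [← Finset.mul_sum, ← hu.sum_range_loss x T, ENNReal.ofNNReal_finsetSum]

lemma exists_isCausalAlong_of_isSurvivalProcess [StandardBorelSpace E] [IsFiniteMeasure μ]
    [IsFiniteMeasure ν] (hu : IsSurvivalProcess ℱ u) (hv : IsSurvivalProcess ℱ v)
    (huv : ∀ t A, MeasurableSet[ℱ t] A → ∫⁻ x in A, u t x ∂μ = ∫⁻ x in A, v t x ∂ν)
    (hT : mE ≤ ℱ T) :
    ∃ π : Measure (E × E), IsCausalAlong ℱ T μ π ∧ IsCausalAlong ℱ T ν (π.map Prod.swap) ∧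
      ∀ φ : E → ℝ≥0∞, Measurable φ → ∫⁻ p in {p : E × E | p.1 ≠ p.2}, (φ p.1 + φ p.2) ∂π
        ≤ ∫⁻ x, φ x * (1 - u T x : ℝ≥0) ∂μ + ∫⁻ y, φ y * (1 - v T y : ℝ≥0) ∂ν := by
  have hfin (t : ℕ) : IsFiniteMeasure (lossMeasure μ u t) :=
    isFiniteMeasure_of_le μ (lossMeasure_le hu t)
  have hfin' (t : ℕ) : IsFiniteMeasure (lossMeasure ν v t) :=
    isFiniteMeasure_of_le ν (lossMeasure_le hv t)
  let ρ t := condIndepGluing (ℱ.le t) (lossMeasure μ u t) (lossMeasure ν v t)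
  have hρ (t : ℕ) : IsGluedAlong (ℱ t) (lossMeasure μ u t) (ρ t) :=
    isGluedAlong_condIndepGluing (ℱ.le t) (trim_lossMeasure_eq hu hv huv t)
  have hρ' (t : ℕ) : IsGluedAlong (ℱ t) (lossMeasure ν v t) ((ρ t).map Prod.swap) := by
    have htrim := trim_lossMeasure_eq hu hv huv t
    rw [map_swap_condIndepGluing (ℱ.le t) htrim]
    exact isGluedAlong_condIndepGluing (ℱ.le t) htrim.symm
  have hswap : (splitCoupling μ u T ρ).map Prod.swap
      = splitCoupling ν v T fun t => (ρ t).map Prod.swap := by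
    refine map_swap_splitCoupling (Measure.ext fun A hA => ?_)
    rw [withDensity_apply _ hA, withDensity_apply _ hA, huv T A (hT _ hA)]
  refine ⟨splitCoupling μ u T ρ, isCausalAlong_splitCoupling hu hρ,
    hswap ▸ isCausalAlong_splitCoupling hv hρ', fun φ hφ => ?_⟩
  have hφ₁ : Measurable fun p : E × E => φ p.1 := hφ.comp measurable_fst
  have hsnd : ∫⁻ p in {p : E × E | p.1 ≠ p.2}, φ p.2 ∂splitCoupling μ u T ρ
      = ∫⁻ p in {p : E × E | p.1 ≠ p.2}, φ p.1 ∂(splitCoupling μ u T ρ).map Prod.swap := by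
    rw [setLIntegral_map measurableSet_fst_ne_snd hφ₁ measurable_swap]
    simp [ne_comm]
  rw [lintegral_add_left hφ₁, hsnd, hswap]
  exact add_le_add (setLIntegral_fst_ne_splitCoupling_le hu hρ hφ)
    (setLIntegral_fst_ne_splitCoupling_le hv hρ' hφ)

end SplitCoupling

section ChainRule

variable {E E' : Type*} {m mE : MeasurableSpace E} {mE' : MeasurableSpace E'} {μ ν : Measure E}

lemma klDiv_map_of_leftInverse [IsFiniteMeasure μ] [IsFiniteMeasure ν] {f : E → E'} {g : E' → E}
    (hf : Measurable f) (hg : Measurable g) (h : Function.LeftInverse g f) :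
    klDiv (ν.map f) (μ.map f) = klDiv ν μ := by
  have hinv (γ : Measure E) : (γ.map f).map g = γ := by
    rw [Measure.map_map hg hf, h.comp_eq_id, Measure.map_id]
  refine le_antisymm (klDiv_map_le ν μ hf) ?_
  conv_lhs => rw [← hinv ν, ← hinv μ]
  exact klDiv_map_le _ _ hg

lemma trim_withDensity_eq (hm : m ≤ mE) {f : E → ℝ≥0∞} (hf : Measurable[m] f) :
    (μ.withDensity f).trim hm = (μ.trim hm).withDensity f := by
  refine @Measure.ext _ m _ _ fun A hA => ?_
  rw [trim_measurableSet_eq hm hA, withDensity_apply _ (hm _ hA), withDensity_apply _ hA,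
    setLIntegral_trim hm hf hA]

lemma trim_withDensity_compProd_condExpKernel [StandardBorelSpace E] [IsFiniteMeasure μ]
    (hm : m ≤ mE) {f : E → ℝ≥0∞} (hf : Measurable[m] f) [IsFiniteMeasure (μ.withDensity f)] :
    (μ.withDensity f).trim hm ⊗ₘ condExpKernel μ m
      = @Measure.map E (E × E) mE (m.prod mE) Function.diag (μ.withDensity f) := by
  refine @Measure.ext_prod _ _ m mE _ _ _ fun {A B} hA hB => ?_
  have hκ : Measurable[m] fun x => condExpKernel μ m x B := measurable_condExpKernel hB
  calc ((μ.withDensity f).trim hm ⊗ₘ condExpKernel μ m) (A ×ˢ B)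
      = ∫⁻ x in A, f x * condExpKernel μ m x B ∂μ.trim hm := by
        rw [Measure.compProd_apply_prod hA hB, trim_withDensity_eq hm hf,
          setLIntegral_withDensity_eq_setLIntegral_mul _ hf hκ hA]
        rfl
    _ = ∫⁻ x, condExpKernel μ m x B * A.indicator f x ∂μ.trim hm := by
        rw [← lintegral_indicator hA]
        exact lintegral_congr fun x => by rw [Set.indicator_mul_left, mul_comm]
    _ = ∫⁻ x in B ∩ A, f x ∂μ := by
        rw [lintegral_condExpKernel_mul hm hB (Measurable.indicator hf hA),
          setLIntegral_indicator (hm _ hA), Set.inter_comm]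
    _ = @Measure.map E (E × E) mE (m.prod mE) Function.diag (μ.withDensity f) (A ×ˢ B) := by
        rw [@Measure.map_apply _ _ _ (m.prod mE) _ _ (measurable_diag_of_le hm) _ (hA.prod hB),
          ← withDensity_apply _ (hB.inter (hm _ hA)), Set.inter_comm]
        rfl

lemma klDiv_eq_klDiv_trim_add_of_trim_eq [StandardBorelSpace E] [IsFiniteMeasure μ]
    [IsFiniteMeasure ν] (hm : m ≤ mE) {f : E → ℝ≥0∞} (hf : Measurable[m] f)
    (h : ν.trim hm = (μ.withDensity f).trim hm) :
    klDiv ν μ = klDiv (ν.trim hm) (μ.trim hm) + klDiv ν (μ.withDensity f) := by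
  have hfin : IsFiniteMeasure (μ.withDensity f) := ⟨by
    rw [← trim_measurableSet_eq hm .univ, ← h]
    exact measure_lt_top _ _⟩
  have hdiag (γ : Measure E) [IsFiniteMeasure γ] :
      @klDiv _ (m.prod mE) (@Measure.map _ _ mE (m.prod mE) Function.diag ν)
        (@Measure.map _ _ mE (m.prod mE) Function.diag γ) = klDiv ν γ :=
    @klDiv_map_of_leftInverse _ _ mE (m.prod mE) γ ν _ _ _ Prod.snd
      (measurable_diag_of_le hm) (@measurable_snd _ _ m mE) fun _ => rfl
  rw [← hdiag μ, ← hdiag (μ.withDensity f), ← trim_withDensity_compProd_condExpKernel hm hf, ← h,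
    ← compProd_trim_condExpKernel hm, ← compProd_trim_condExpKernel hm]
  exact klDiv_compProd_eq_add _ _ _ _

end ChainRule

section KeptRatio

lemma sq_one_sub_le_two_mul_klFun {x : ℝ} (h0 : 0 ≤ x) (h1 : x ≤ 1) :
    (1 - x) ^ 2 ≤ 2 * klFun x := by
  rcases h0.eq_or_lt with rfl | h0
  · simp [klFun_zero]
  · have hsinh := Real.sinh_le_self_iff.2 (Real.log_nonpos h0.le h1)
    rw [Real.sinh_log h0] at hsinh
    have hmul := mul_le_mul_of_nonneg_left hsinh h0.le
    have hexpand : x * ((x - x⁻¹) / 2) = (x ^ 2 - 1) / 2 := by field_simp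
    rw [klFun_apply]
    linarith

lemma mul_sq_one_sub_inv_le_two_mul_klFun {x : ℝ} (h1 : 1 ≤ x) :
    x * (1 - x⁻¹) ^ 2 ≤ 2 * klFun x := by
  have h0 : 0 < x := by linarith
  have hlog := Real.le_log_one_add_of_nonneg (sub_nonneg.2 h1)
  rw [add_sub_cancel, div_le_iff₀ (by linarith)] at hlog
  have hsq : x * (1 - x⁻¹) ^ 2 = (x - 1) ^ 2 / x := by field_simp
  rw [hsq, div_le_iff₀ h0, klFun_apply]
  refine le_of_mul_le_mul_right ?_ (by linarith : 0 < x + 1)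
  nlinarith [mul_le_mul_of_nonneg_left hlog (sq_nonneg x), pow_nonneg (sub_nonneg.2 h1) 3]

lemma coe_le_two_mul_ofReal {c : ℝ≥0} {x : ℝ} (h : c ≤ 2 * x) :
    (c : ℝ≥0∞) ≤ 2 * ENNReal.ofReal x := by
  rw [← ENNReal.ofReal_coe_nnreal, ← ENNReal.ofReal_ofNat 2, ← ENNReal.ofReal_mul zero_le_two]
  exact ENNReal.ofReal_le_ofReal h

lemma sq_one_sub_min_one_le (r : ℝ≥0) :
    ((1 - min 1 r : ℝ≥0) : ℝ≥0∞) ^ 2 ≤ 2 * ENNReal.ofReal (klFun r) := by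
  rcases le_total 1 r with h | h
  · simp [h]
  · have hreal : (((1 - r) ^ 2 : ℝ≥0) : ℝ) ≤ 2 * klFun r := by
      rw [NNReal.coe_pow, NNReal.coe_sub h, NNReal.coe_one]
      exact sq_one_sub_le_two_mul_klFun r.2 (by exact_mod_cast h)
    rw [min_eq_right h]
    exact_mod_cast coe_le_two_mul_ofReal hreal

lemma sq_one_sub_min_one_inv_mul_le (r : ℝ≥0) :
    ((1 - min 1 r⁻¹ : ℝ≥0) : ℝ≥0∞) ^ 2 * r ≤ 2 * ENNReal.ofReal (klFun r) := by
  rcases le_total r 1 with h | h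
  · rcases eq_or_ne r 0 with rfl | hr
    · simp
    · simp [one_le_inv₀ (pos_iff_ne_zero.2 hr), h]
  · have hinv : r⁻¹ ≤ 1 := inv_le_one_of_one_le₀ h
    have hreal : (((1 - r⁻¹) ^ 2 * r : ℝ≥0) : ℝ) ≤ 2 * klFun r := by
      rw [mul_comm, NNReal.coe_mul, NNReal.coe_pow, NNReal.coe_sub hinv, NNReal.coe_inv,
        NNReal.coe_one]
      exact mul_sq_one_sub_inv_le_two_mul_klFun (by exact_mod_cast h)
    rw [min_eq_right hinv]
    exact_mod_cast coe_le_two_mul_ofReal hreal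

lemma min_one_inv_mul_self (r : ℝ≥0) : min 1 r⁻¹ * r = min 1 r := by
  rcases eq_or_ne r 0 with rfl | hr
  · simp
  · rw [min_mul_of_nonneg _ _ zero_le, one_mul, inv_mul_cancel₀ hr, min_comm]

end KeptRatio

section TrimDensity

variable {E : Type*} {m m' mE : MeasurableSpace E} {μ ν : Measure E}

lemma exists_trim_eq_trim_withDensity [IsFiniteMeasure μ] [IsFiniteMeasure ν]
    (hm : m ≤ mE) (hac : ν ≪ μ) :
    ∃ f : E → ℝ≥0, Measurable[m] f ∧
      ν.trim hm = (μ.withDensity fun x => (f x : ℝ≥0∞)).trim hm := by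
  have hf : Measurable[m] fun x => ((ν.trim hm).rnDeriv (μ.trim hm) x).toNNReal :=
    (Measure.measurable_rnDeriv _ _).ennreal_toNNReal
  refine ⟨_, hf, ?_⟩
  rw [trim_withDensity_eq hm hf.coe_nnreal_ennreal]
  conv_lhs => rw [← Measure.withDensity_rnDeriv_eq _ _ (hac.trim hm)]
  refine withDensity_congr_ae ?_
  filter_upwards [Measure.rnDeriv_lt_top (ν.trim hm) (μ.trim hm)] with x hx
  exact (ENNReal.coe_toNNReal hx.ne).symm

lemma ae_eq_zero_of_trim_eq_trim_withDensity (hmm' : m ≤ m') (hm' : m' ≤ mE)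
    {f g : E → ℝ≥0} (hf : Measurable[m] f) (hg : Measurable[m'] g)
    (hνf : ν.trim (hmm'.trans hm') = (μ.withDensity fun x => (f x : ℝ≥0∞)).trim (hmm'.trans hm'))
    (hνg : ν.trim hm' = (μ.withDensity fun x => (g x : ℝ≥0∞)).trim hm') :
    ∀ᵐ x ∂μ, f x = 0 → g x = 0 := by
  let A : Set E := {x | f x = 0}
  have hA : MeasurableSet[m] A := hf (measurableSet_singleton 0)
  have hA' : MeasurableSet A := hm' _ (hmm' _ hA)
  have hint : ∫⁻ x in A, g x ∂μ = 0 := calc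
    ∫⁻ x in A, g x ∂μ = ν A := by
      rw [← withDensity_apply _ hA', ← trim_measurableSet_eq hm' (hmm' _ hA), ← hνg,
        trim_measurableSet_eq hm' (hmm' _ hA)]
    _ = ∫⁻ x in A, f x ∂μ := by
      rw [← withDensity_apply _ hA', ← trim_measurableSet_eq (μ := ν) (hmm'.trans hm') hA, hνf,
        trim_measurableSet_eq _ hA]
    _ = 0 := by
      rw [setLIntegral_congr_fun hA' fun x (hx : f x = 0) => by rw [hx], lintegral_const]
      simp
  have hg' : Measurable fun x => (g x : ℝ≥0∞) := (hg.mono hm' le_rfl).coe_nnreal_ennreal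
  filter_upwards [(ae_restrict_iff' hA').1 ((lintegral_eq_zero_iff hg').1 hint)] with x hx hfx
  exact ENNReal.coe_eq_zero.1 (hx hfx)

end TrimDensity

section LikelihoodRatio

variable {E : Type*} {mE : MeasurableSpace E} {μ ν : Measure E} {ℱ : Filtration ℕ mE}
  {r q : ℕ → E → ℝ≥0}

/-- The product of the ratios of the first `t` steps. -/
def partialProd (q : ℕ → E → ℝ≥0) (t : ℕ) (x : E) : ℝ≥0 := ∏ s ∈ Finset.range t, q s x

lemma partialProd_succ (t : ℕ) (x : E) : partialProd q (t + 1) x = partialProd q t x * q t x :=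
  Finset.prod_range_succ _ _

lemma adapted_partialProd (hq : ∀ t, Measurable[ℱ (t + 1)] (q t)) : Adapted ℱ (partialProd q) :=
  fun _ => Finset.measurable_fun_prod _ fun s hs =>
    (hq s).mono (ℱ.mono (Finset.mem_range.1 hs)) le_rfl

lemma isSurvivalProcess_partialProd (hq : ∀ t, Measurable[ℱ (t + 1)] (q t))
    (hq1 : ∀ t x, q t x ≤ 1) : IsSurvivalProcess ℱ (partialProd q) where
  adapted := adapted_partialProd hq
  antitone x := antitone_nat_of_succ_le fun _ => by
    rw [partialProd_succ]
    exact mul_le_of_le_one_right' (hq1 _ x)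
  zero_eq_one _ := rfl

/-- `r t` is the density ratio of `ν` with respect to `μ` in the transition from time `t` to time
`t + 1`: the partial products of `r` are densities of `ν` with respect to `μ` on the `σ`-algebras of
the filtration. -/
structure IsTransitionRatio (ℱ : Filtration ℕ mE) (μ ν : Measure E) (r : ℕ → E → ℝ≥0) : Prop where
  measurable : ∀ t, Measurable[ℱ (t + 1)] (r t)
  trim_eq : ∀ t,
    ν.trim (ℱ.le t) = (μ.withDensity fun x => (partialProd r t x : ℝ≥0∞)).trim (ℱ.le t)

/-- The relative entropy of the transition from time `t` to time `t + 1`. -/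
noncomputable def transitionEntropy (μ : Measure E) (r : ℕ → E → ℝ≥0) (t : ℕ) : ℝ≥0∞ :=
  ∫⁻ x, ENNReal.ofReal (klFun (r t x)) * partialProd r t x ∂μ

lemma klDiv_withDensity [IsFiniteMeasure μ] {f : E → ℝ≥0} (hf : Measurable f)
    [IsFiniteMeasure (μ.withDensity fun x => (f x : ℝ≥0∞))] :
    klDiv (μ.withDensity fun x => (f x : ℝ≥0∞)) μ = ∫⁻ x, ENNReal.ofReal (klFun (f x)) ∂μ := by
  rw [klDiv_eq_lintegral_klFun_of_ac (withDensity_absolutelyContinuous _ _)]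
  refine lintegral_congr_ae ?_
  filter_upwards [Measure.rnDeriv_withDensity μ hf.coe_nnreal_ennreal] with x hx
  rw [hx, ENNReal.coe_toReal]

namespace IsTransitionRatio

lemma lintegral_eq (h : IsTransitionRatio ℱ μ ν r) {t : ℕ} {g : E → ℝ≥0∞}
    (hg : Measurable[ℱ t] g) : ∫⁻ x, g x ∂ν = ∫⁻ x, g x * partialProd r t x ∂μ := by
  rw [← lintegral_trim (ℱ.le t) hg, h.trim_eq t, lintegral_trim (ℱ.le t) hg,
    lintegral_withDensity_eq_lintegral_mul _ _ (hg.mono (ℱ.le t) le_rfl)]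
  · simp_rw [Pi.mul_apply, mul_comm]
  · exact (((adapted_partialProd h.measurable) t).mono (ℱ.le t) le_rfl).coe_nnreal_ennreal

lemma isFiniteMeasure_withDensity [IsFiniteMeasure ν] (h : IsTransitionRatio ℱ μ ν r) (t : ℕ) :
    IsFiniteMeasure (μ.withDensity fun x => (partialProd r t x : ℝ≥0∞)) := ⟨by
  rw [← trim_measurableSet_eq (ℱ.le t) .univ, ← h.trim_eq t]
  exact measure_lt_top _ _⟩

lemma withDensity_partialProd_succ (h : IsTransitionRatio ℱ μ ν r) (t : ℕ) :
    (μ.withDensity fun x => (partialProd r (t + 1) x : ℝ≥0∞))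
      = (μ.withDensity fun x => (partialProd r t x : ℝ≥0∞)).withDensity fun x => r t x := by
  rw [← withDensity_mul _
    (((adapted_partialProd h.measurable) t).mono (ℱ.le t) le_rfl).coe_nnreal_ennreal
    ((h.measurable t).mono (ℱ.le (t + 1)) le_rfl).coe_nnreal_ennreal]
  congr with x
  rw [partialProd_succ, ENNReal.coe_mul, Pi.mul_apply]

lemma klDiv_trim_withDensity [IsFiniteMeasure ν] (h : IsTransitionRatio ℱ μ ν r) (t : ℕ) :
    klDiv (ν.trim (ℱ.le (t + 1)))
        ((μ.withDensity fun x => (partialProd r t x : ℝ≥0∞)).trim (ℱ.le (t + 1)))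
      = transitionEntropy μ r t := by
  have hfin := h.isFiniteMeasure_withDensity t
  have hν : ν.trim (ℱ.le (t + 1))
      = ((μ.withDensity fun x => (partialProd r t x : ℝ≥0∞)).trim (ℱ.le (t + 1))).withDensity
        fun x => r t x := by
    rw [h.trim_eq, h.withDensity_partialProd_succ,
      trim_withDensity_eq _ (h.measurable t).coe_nnreal_ennreal]
  have hfin' : IsFiniteMeasure
      (((μ.withDensity fun x => (partialProd r t x : ℝ≥0∞)).trim (ℱ.le (t + 1))).withDensity
        fun x => (r t x : ℝ≥0∞)) := hν ▸ isFiniteMeasure_trim (ℱ.le (t + 1))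
  have hkl : Measurable[ℱ (t + 1)] fun x => ENNReal.ofReal (klFun (r t x)) :=
    (measurable_klFun.comp (h.measurable t).coe_nnreal_real).ennreal_ofReal
  rw [hν, @klDiv_withDensity E (ℱ (t + 1)) _ _ _ (h.measurable t), lintegral_trim _ hkl,
    lintegral_withDensity_eq_lintegral_mul _ _ (hkl.mono (ℱ.le _) le_rfl), transitionEntropy]
  · simp_rw [Pi.mul_apply, mul_comm]
  · exact (((adapted_partialProd h.measurable) t).mono (ℱ.le t) le_rfl).coe_nnreal_ennreal

lemma sum_transitionEntropy_add_klDiv [StandardBorelSpace E] [IsFiniteMeasure μ]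
    [IsFiniteMeasure ν] (h : IsTransitionRatio ℱ μ ν r) (T : ℕ) :
    ∑ t ∈ Finset.range T, transitionEntropy μ r t
      + klDiv ν (μ.withDensity fun x => (partialProd r T x : ℝ≥0∞)) = klDiv ν μ := by
  induction T with
  | zero => simp [partialProd]
  | succ T ih =>
    have hfin := h.isFiniteMeasure_withDensity T
    have htrim := h.trim_eq (T + 1)
    rw [h.withDensity_partialProd_succ] at htrim
    rw [Finset.sum_range_succ, h.withDensity_partialProd_succ, add_assoc,
      ← h.klDiv_trim_withDensity, ← klDiv_eq_klDiv_trim_add_of_trim_eq (ℱ.le (T + 1))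
        (h.measurable T).coe_nnreal_ennreal htrim, ih]

end IsTransitionRatio

lemma exists_isTransitionRatio [IsFiniteMeasure μ] [IsFiniteMeasure ν] (hac : ν ≪ μ)
    (h0 : ν.trim (ℱ.le 0) = μ.trim (ℱ.le 0)) : ∃ r, IsTransitionRatio ℱ μ ν r := by
  have hdensity (t : ℕ) : ∃ f : E → ℝ≥0, Measurable[ℱ t] f ∧
      ν.trim (ℱ.le t) = (μ.withDensity fun x => (f x : ℝ≥0∞)).trim (ℱ.le t) ∧ (t = 0 → f = 1) := by
    rcases t with _ | t
    · exact ⟨1, measurable_const, by simpa using h0, fun _ => rfl⟩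
    · obtain ⟨f, hf, hνf⟩ := exists_trim_eq_trim_withDensity (ℱ.le (t + 1)) hac
      exact ⟨f, hf, hνf, by simp⟩
  choose ℓ hℓ hνℓ hℓ0 using hdensity
  have hprod (t : ℕ) : partialProd (fun t x => ℓ (t + 1) x / ℓ t x) t =ᵐ[μ] ℓ t := by
    induction t with
    | zero => rw [hℓ0 0 rfl]; rfl
    | succ t ih =>
      filter_upwards [ih, ae_eq_zero_of_trim_eq_trim_withDensity (ℱ.mono t.le_succ) (ℱ.le _)
        (hℓ t) (hℓ (t + 1)) (hνℓ t) (hνℓ (t + 1))] with x hx hzero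
      rw [partialProd_succ, hx, mul_div_cancel_of_imp' hzero]
  refine ⟨fun t x => ℓ (t + 1) x / ℓ t x, fun t =>
    (hℓ (t + 1)).div ((hℓ t).mono (ℱ.mono t.le_succ) le_rfl), fun t => ?_⟩
  rw [hνℓ t, withDensity_congr_ae]
  filter_upwards [hprod t] with x hx
  rw [hx]

end LikelihoodRatio

section SurvivalLoss

variable {E : Type*} {mE : MeasurableSpace E} {μ ν γ : Measure E} {ℱ : Filtration ℕ mE}
  {r q u : ℕ → E → ℝ≥0} {c : ℝ≥0∞}

lemma IsSurvivalProcess.lintegral_sq_one_sub_le (hu : IsSurvivalProcess ℱ u) (T : ℕ) :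
    ∫⁻ x, ((1 - u T x : ℝ≥0) : ℝ≥0∞) ^ 2 ∂γ
      ≤ T * ∑ t ∈ Finset.range T, ∫⁻ x, ((u t x - u (t + 1) x : ℝ≥0) : ℝ≥0∞) ^ 2 ∂γ := by
  have hloss (t : ℕ) : Measurable fun x => ((u t x - u (t + 1) x : ℝ≥0) : ℝ≥0∞) ^ 2 :=
    ((hu.measurable_loss t).mono (ℱ.le _) le_rfl).pow_const 2
  rw [← lintegral_finsetSum _ fun t _ => hloss t,
    ← lintegral_const_mul _ (Finset.measurable_fun_sum _ fun t _ => hloss t)]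
  refine lintegral_mono fun x => ?_
  rw [← hu.sum_range_loss x T]
  have hsq := sq_sum_le_card_mul_sum_sq (s := Finset.range T) (f := fun t => u t x - u (t + 1) x)
  rw [Finset.card_range] at hsq
  simpa only [ENNReal.coe_pow, ENNReal.coe_mul, ENNReal.coe_natCast, ENNReal.ofNNReal_finsetSum]
    using ENNReal.coe_le_coe.2 hsq

lemma lintegral_sq_one_sub_le_one [IsProbabilityMeasure γ] (w : E → ℝ≥0) :
    ∫⁻ x, ((1 - w x : ℝ≥0) : ℝ≥0∞) ^ 2 ∂γ ≤ 1 := calc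
  _ ≤ ∫⁻ _, 1 ∂γ := lintegral_mono fun x =>
    pow_le_one₀ zero_le (ENNReal.coe_le_one_iff.2 tsub_le_self)
  _ = 1 := by simp

/-- The fraction `∏ min(1, r)` of the mass of the first measure that stays on the diagonal. -/
def survivalFst (r : ℕ → E → ℝ≥0) : ℕ → E → ℝ≥0 := partialProd fun t x => min 1 (r t x)

/-- The fraction `∏ min(1, 1 / r)` of the mass of the second measure that stays on the diagonal.
Where `r = 0` the junk value `r⁻¹ = 0` is harmless, because the second measure gives these points
no mass. -/
noncomputable def survivalSnd (r : ℕ → E → ℝ≥0) : ℕ → E → ℝ≥0 :=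
  partialProd fun t x => min 1 (r t x)⁻¹

lemma survivalSnd_mul_partialProd (t : ℕ) (x : E) :
    survivalSnd r t x * partialProd r t x = survivalFst r t x := by
  simp_rw [survivalSnd, survivalFst, partialProd, ← Finset.prod_mul_distrib, min_one_inv_mul_self]

lemma partialProd_sub_partialProd_succ (t : ℕ) (x : E) :
    partialProd q t x - partialProd q (t + 1) x = partialProd q t x * (1 - q t x) := by
  rw [partialProd_succ, mul_tsub, mul_one]

namespace IsTransitionRatio

lemma isSurvivalProcess_survivalFst (h : IsTransitionRatio ℱ μ ν r) :
    IsSurvivalProcess ℱ (survivalFst r) :=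
  isSurvivalProcess_partialProd (fun t => measurable_const.min (h.measurable t))
    fun _ _ => min_le_left _ _

lemma isSurvivalProcess_survivalSnd (h : IsTransitionRatio ℱ μ ν r) :
    IsSurvivalProcess ℱ (survivalSnd r) :=
  isSurvivalProcess_partialProd (fun t => measurable_const.min (h.measurable t).inv)
    fun _ _ => min_le_left _ _

lemma setLIntegral_survival_eq (h : IsTransitionRatio ℱ μ ν r) (t : ℕ) {A : Set E}
    (hA : MeasurableSet[ℱ t] A) :
    ∫⁻ x in A, survivalFst r t x ∂μ = ∫⁻ x in A, survivalSnd r t x ∂ν := by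
  have hind : Measurable[ℱ t] (A.indicator fun x => (survivalSnd r t x : ℝ≥0∞)) :=
    Measurable.indicator (h.isSurvivalProcess_survivalSnd.adapted t).coe_nnreal_ennreal hA
  rw [← lintegral_indicator (ℱ.le t _ hA), ← lintegral_indicator (ℱ.le t _ hA),
    h.lintegral_eq hind]
  refine lintegral_congr fun x => ?_
  simp_rw [← survivalSnd_mul_partialProd, ENNReal.coe_mul, Set.indicator_mul_left]

lemma lintegral_sq_loss_survivalFst_le (h : IsTransitionRatio ℱ μ ν r) (t : ℕ) :
    ∫⁻ x, ((survivalFst r t x - survivalFst r (t + 1) x : ℝ≥0) : ℝ≥0∞) ^ 2 ∂μ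
      ≤ 2 * transitionEntropy μ r t := by
  rw [transitionEntropy, ← lintegral_const_mul' _ _ ENNReal.ofNat_ne_top]
  refine lintegral_mono fun x => ?_
  have hle : survivalFst r t x ^ 2 ≤ partialProd r t x := calc
    survivalFst r t x ^ 2 ≤ survivalFst r t x :=
      pow_le_of_le_one zero_le (h.isSurvivalProcess_survivalFst.le_one t x) two_ne_zero
    _ ≤ partialProd r t x := Finset.prod_le_prod' fun s _ => min_le_right 1 (r s x)
  calc ((survivalFst r t x - survivalFst r (t + 1) x : ℝ≥0) : ℝ≥0∞) ^ 2
      = ((1 - min 1 (r t x) : ℝ≥0) : ℝ≥0∞) ^ 2 * (survivalFst r t x ^ 2 : ℝ≥0) := by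
        rw [survivalFst, partialProd_sub_partialProd_succ]
        push_cast
        ring
    _ ≤ 2 * ENNReal.ofReal (klFun (r t x)) * partialProd r t x :=
        mul_le_mul' (sq_one_sub_min_one_le _) (ENNReal.coe_le_coe.2 hle)
    _ = _ := mul_assoc _ _ _

lemma lintegral_sq_loss_survivalSnd_le (h : IsTransitionRatio ℱ μ ν r) (t : ℕ) :
    ∫⁻ x, ((survivalSnd r t x - survivalSnd r (t + 1) x : ℝ≥0) : ℝ≥0∞) ^ 2 ∂ν
      ≤ 2 * transitionEntropy μ r t := by
  rw [h.lintegral_eq ((h.isSurvivalProcess_survivalSnd.measurable_loss t).pow_const 2),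
    transitionEntropy, ← lintegral_const_mul' _ _ ENNReal.ofNat_ne_top]
  refine lintegral_mono fun x => ?_
  have hle : survivalSnd r t x ^ 2 ≤ 1 :=
    pow_le_one₀ zero_le (h.isSurvivalProcess_survivalSnd.le_one t x)
  calc ((survivalSnd r t x - survivalSnd r (t + 1) x : ℝ≥0) : ℝ≥0∞) ^ 2 * partialProd r (t + 1) x
      = (survivalSnd r t x ^ 2 : ℝ≥0)
          * (((1 - min 1 (r t x)⁻¹ : ℝ≥0) : ℝ≥0∞) ^ 2 * r t x * partialProd r t x) := by
        rw [survivalSnd, partialProd_sub_partialProd_succ, partialProd_succ]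
        push_cast
        ring
    _ ≤ 1 * (2 * ENNReal.ofReal (klFun (r t x)) * partialProd r t x) :=
        mul_le_mul' (ENNReal.coe_le_one_iff.2 hle)
          (mul_le_mul_left (sq_one_sub_min_one_inv_mul_le _) _)
    _ = _ := by rw [one_mul, mul_assoc]

lemma lintegral_sq_one_sub_le [StandardBorelSpace E] [IsFiniteMeasure μ] [IsFiniteMeasure ν]
    (h : IsTransitionRatio ℱ μ ν r) (hu : IsSurvivalProcess ℱ u)
    (hloss : ∀ t, ∫⁻ x, ((u t x - u (t + 1) x : ℝ≥0) : ℝ≥0∞) ^ 2 ∂γ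
      ≤ 2 * transitionEntropy μ r t) (T : ℕ) :
    ∫⁻ x, ((1 - u T x : ℝ≥0) : ℝ≥0∞) ^ 2 ∂γ ≤ T * (2 * klDiv ν μ) := calc
  _ ≤ T * ∑ t ∈ Finset.range T, ∫⁻ x, ((u t x - u (t + 1) x : ℝ≥0) : ℝ≥0∞) ^ 2 ∂γ :=
      hu.lintegral_sq_one_sub_le T
  _ ≤ T * ∑ t ∈ Finset.range T, 2 * transitionEntropy μ r t := by
      gcongr with t
      exact hloss t
  _ ≤ T * (2 * klDiv ν μ) := by
      rw [← Finset.mul_sum, ← h.sum_transitionEntropy_add_klDiv T]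
      gcongr
      exact le_self_add

end IsTransitionRatio

end SurvivalLoss

section Gibbs

variable {E : Type*} {mE : MeasurableSpace E} {μ ν γ : Measure E}

/-- `log ∫ exp f dμ`, as an element of `[0, ∞]`. If `μ` has mass less than one, the logarithm may
be negative, and the value is then `0`. -/
noncomputable def logExpMoment (μ : Measure E) (f : E → ℝ≥0) : ℝ≥0∞ :=
  (ENNReal.log (∫⁻ x, ENNReal.ofReal (Real.exp (f x)) ∂μ)).toENNReal

lemma one_le_lintegral_exp [IsProbabilityMeasure μ] (f : E → ℝ≥0) :
    1 ≤ ∫⁻ x, ENNReal.ofReal (Real.exp (f x)) ∂μ := calc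
  1 = ∫⁻ _, 1 ∂μ := by simp
  _ ≤ _ := lintegral_mono fun x => ENNReal.one_le_ofReal.2 (Real.one_le_exp (f x).2)

lemma toENNReal_one_add_log_lintegral_exp [IsProbabilityMeasure μ] (f : E → ℝ≥0) :
    (1 + ENNReal.log (∫⁻ x, ENNReal.ofReal (Real.exp (f x)) ∂μ)).toENNReal
      = 1 + logExpMoment μ f := by
  rw [EReal.toENNReal_add zero_le_one (ENNReal.zero_le_log_iff.2 (one_le_lintegral_exp f)),
    logExpMoment]
  congr
  exact_mod_cast EReal.toENNReal_coe (x := 1)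

lemma mul_le_klFun_add_exp {b : ℝ} (hb : 0 ≤ b) (u : ℝ) : b * u ≤ klFun b - 1 + Real.exp u := by
  rcases hb.eq_or_lt with rfl | hb
  · simp [klFun_zero, Real.exp_nonneg]
  · have hexp := mul_le_mul_of_nonneg_left (Real.add_one_le_exp (u - Real.log b)) hb.le
    rw [Real.exp_sub, Real.exp_log hb, mul_div_cancel₀ _ hb.ne'] at hexp
    rw [klFun_apply]
    linarith

lemma coe_mul_add_one_le_klFun_add {z : ℝ} (hz : 1 ≤ z) (a b : ℝ≥0) :
    (a : ℝ≥0∞) * b + 1 ≤ ENNReal.ofReal (klFun b) + ENNReal.ofReal (Real.log z) * b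
      + ENNReal.ofReal z⁻¹ * ENNReal.ofReal (Real.exp a) := by
  have hz0 : 0 < z := zero_lt_one.trans_le hz
  have hlog : 0 ≤ Real.log z := Real.log_nonneg hz
  have hkl : 0 ≤ klFun b := klFun_nonneg b.2
  have hyoung := mul_le_klFun_add_exp b.coe_nonneg (a - Real.log z)
  rw [Real.exp_sub, Real.exp_log hz0, div_eq_inv_mul] at hyoung
  rw [← ENNReal.ofReal_coe_nnreal (p := a), ← ENNReal.ofReal_coe_nnreal (p := b),
    ← ENNReal.ofReal_mul a.coe_nonneg, ← ENNReal.ofReal_mul hlog,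
    ← ENNReal.ofReal_mul (by positivity), ← ENNReal.ofReal_one,
    ← ENNReal.ofReal_add (by positivity) zero_le_one,
    ← ENNReal.ofReal_add hkl (by positivity),
    ← ENNReal.ofReal_add (by positivity) (by positivity)]
  refine ENNReal.ofReal_le_ofReal ?_
  linarith

lemma lintegral_mul_le_lintegral_klFun_add_logExpMoment [IsProbabilityMeasure μ] {b : E → ℝ≥0}
    (hb : Measurable b) (hb1 : ∫⁻ x, b x ∂μ = 1) {f : E → ℝ≥0} (hf : Measurable f) :
    ∫⁻ x, (f x : ℝ≥0∞) * b x ∂μ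
      ≤ ∫⁻ x, ENNReal.ofReal (klFun (b x)) ∂μ + logExpMoment μ f := by
  rcases eq_or_ne (∫⁻ x, ENNReal.ofReal (Real.exp (f x)) ∂μ) ∞ with htop | hfin
  · simp [logExpMoment, htop]
  obtain ⟨z, hz⟩ : ∃ z : ℝ, ∫⁻ x, ENNReal.ofReal (Real.exp (f x)) ∂μ = ENNReal.ofReal z :=
    ⟨_, (ENNReal.ofReal_toReal hfin).symm⟩
  have hz1 : 1 ≤ z := ENNReal.one_le_ofReal.1 (hz ▸ one_le_lintegral_exp f)
  have hz0 : 0 < z := zero_lt_one.trans_le hz1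
  have hlog : logExpMoment μ f = ENNReal.ofReal (Real.log z) := by
    rw [logExpMoment, hz, ENNReal.log_ofReal_of_pos hz0, EReal.toENNReal_of_ne_top (by simp),
      EReal.toReal_coe]
  have hexp : Measurable fun x => ENNReal.ofReal (Real.exp (f x)) :=
    (Real.measurable_exp.comp hf.coe_nnreal_real).ennreal_ofReal
  have hint := lintegral_mono (μ := μ) fun x => coe_mul_add_one_le_klFun_add hz1 (f x) (b x)
  rw [lintegral_add_right _ measurable_const, lintegral_add_right _ (hexp.const_mul _),
    lintegral_add_right _ (hb.coe_nnreal_ennreal.const_mul _), lintegral_const_mul _ hexp,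
    lintegral_const_mul _ hb.coe_nnreal_ennreal, hb1, hz, ← ENNReal.ofReal_mul (by positivity),
    inv_mul_cancel₀ hz0.ne', lintegral_const, measure_univ, mul_one, mul_one,
    ENNReal.ofReal_one] at hint
  rw [hlog]
  exact (ENNReal.add_le_add_iff_right ENNReal.one_ne_top).1 hint

lemma lintegral_le_klDiv_add_logExpMoment [IsProbabilityMeasure μ] [IsProbabilityMeasure ν]
    {f : E → ℝ≥0} (hf : Measurable f) :
    ∫⁻ x, f x ∂ν ≤ klDiv ν μ + logExpMoment μ f := by
  rcases eq_or_ne (klDiv ν μ) ∞ with htop | hfin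
  · simp [htop]
  have hac : ν ≪ μ := (klDiv_ne_top_iff.1 hfin).1
  obtain ⟨b, hb, hν⟩ := exists_trim_eq_trim_withDensity le_rfl hac
  rw [trim_eq_self, trim_eq_self] at hν
  have hb1 : ∫⁻ x, b x ∂μ = 1 := by
    rw [← setLIntegral_univ, ← withDensity_apply _ .univ, ← hν, measure_univ]
  have hfin : IsFiniteMeasure (μ.withDensity fun x => (b x : ℝ≥0∞)) := hν ▸ inferInstance
  have hmain := lintegral_mul_le_lintegral_klFun_add_logExpMoment hb hb1 hf
  rw [← klDiv_withDensity hb, ← hν] at hmain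
  rw [hν, lintegral_withDensity_eq_lintegral_mul _ hb.coe_nnreal_ennreal hf.coe_nnreal_ennreal,
    ← hν]
  simpa only [Pi.mul_apply, mul_comm] using hmain

end Gibbs

section EntropyBound

variable {E : Type*} {mE : MeasurableSpace E} {μ ν : Measure E} {ℱ : Filtration ℕ mE} {T : ℕ}

lemma lintegral_mul_le_sqrt_mul_sqrt {f g : E → ℝ≥0∞} (hf : Measurable f) (hg : Measurable g)
    {a b : ℝ≥0∞} (ha : ∫⁻ x, f x ^ 2 ∂μ ≤ a) (hb : ∫⁻ x, g x ^ 2 ∂μ ≤ b) :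
    ∫⁻ x, f x * g x ∂μ ≤ a ^ (1 / 2 : ℝ) * b ^ (1 / 2 : ℝ) := by
  refine (ENNReal.lintegral_mul_le_Lp_mul_Lq μ Real.HolderConjugate.two_two hf.aemeasurable
    hg.aemeasurable).trans ?_
  simp only [ENNReal.rpow_ofNat]
  gcongr

/-- The bound on the cost of leaving the diagonal in `T` steps, for the relative entropy `K` and the
logarithm `l` of the exponential moment of the squared weight. -/
noncomputable def entropyBound (T : ℕ) (l K : ℝ≥0∞) : ℝ≥0∞ :=
  ENNReal.ofReal (2 * Real.sqrt T + 1) * (1 + l) ^ (1 / 2 : ℝ) * (2 * K) ^ (1 / 2 : ℝ)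

lemma sqrt_mul_add_sqrt_mul_le_entropyBound (l K : ℝ≥0∞) {s : ℝ≥0∞} (hs : s ≤ T * (2 * K))
    (hs1 : s ≤ 1) :
    l ^ (1 / 2 : ℝ) * s ^ (1 / 2 : ℝ) + (K + l) ^ (1 / 2 : ℝ) * s ^ (1 / 2 : ℝ)
      ≤ entropyBound T l K := by
  have hhalf : (0 : ℝ) ≤ 1 / 2 := one_half_pos.le
  have hT : (T : ℝ≥0∞) ^ (1 / 2 : ℝ) = ENNReal.ofReal (Real.sqrt T) := by
    rw [Real.sqrt_eq_rpow, ← ENNReal.ofReal_rpow_of_nonneg (Nat.cast_nonneg T) hhalf,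
      ENNReal.ofReal_natCast]
  have hsT : s ^ (1 / 2 : ℝ) ≤ ENNReal.ofReal (Real.sqrt T) * (2 * K) ^ (1 / 2 : ℝ) := by
    rw [← hT, ← ENNReal.mul_rpow_of_nonneg _ _ hhalf]
    exact ENNReal.rpow_le_rpow hs hhalf
  have hlt : l ^ (1 / 2 : ℝ) ≤ (1 + l) ^ (1 / 2 : ℝ) := ENNReal.rpow_le_rpow le_add_self hhalf
  have hl1 : 1 ≤ (1 + l) ^ (1 / 2 : ℝ) := ENNReal.one_le_rpow le_self_add one_half_pos
  have hK : K ^ (1 / 2 : ℝ) ≤ (2 * K) ^ (1 / 2 : ℝ) :=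
    ENNReal.rpow_le_rpow (le_mul_of_one_le_left zero_le one_le_two) hhalf
  calc l ^ (1 / 2 : ℝ) * s ^ (1 / 2 : ℝ) + (K + l) ^ (1 / 2 : ℝ) * s ^ (1 / 2 : ℝ)
      ≤ l ^ (1 / 2 : ℝ) * s ^ (1 / 2 : ℝ)
          + (K ^ (1 / 2 : ℝ) + l ^ (1 / 2 : ℝ)) * s ^ (1 / 2 : ℝ) := by
        gcongr
        exact ENNReal.rpow_add_le_add_rpow _ _ hhalf (by norm_num)
    _ = 2 * (l ^ (1 / 2 : ℝ) * s ^ (1 / 2 : ℝ)) + K ^ (1 / 2 : ℝ) * s ^ (1 / 2 : ℝ) := by ring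
    _ ≤ 2 * ((1 + l) ^ (1 / 2 : ℝ) * (ENNReal.ofReal (Real.sqrt T) * (2 * K) ^ (1 / 2 : ℝ)))
          + (2 * K) ^ (1 / 2 : ℝ) * (1 + l) ^ (1 / 2 : ℝ) :=
        add_le_add (by gcongr) (mul_le_mul' hK ((ENNReal.rpow_le_one hs1 hhalf).trans hl1))
    _ = entropyBound T l K := by
        rw [entropyBound, ENNReal.ofReal_add (by positivity) zero_le_one,
          ENNReal.ofReal_mul zero_le_two, ENNReal.ofReal_ofNat, ENNReal.ofReal_one]
        ring

lemma lintegral_mul_add_lintegral_mul_le_entropyBound [IsProbabilityMeasure μ]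
    [IsProbabilityMeasure ν] {φ u v : E → ℝ≥0} (hφ : Measurable φ) (hu : Measurable u)
    (hv : Measurable v)
    (hμ : ∫⁻ x, ((1 - u x : ℝ≥0) : ℝ≥0∞) ^ 2 ∂μ ≤ T * (2 * klDiv ν μ))
    (hν : ∫⁻ y, ((1 - v y : ℝ≥0) : ℝ≥0∞) ^ 2 ∂ν ≤ T * (2 * klDiv ν μ)) :
    ∫⁻ x, (φ x : ℝ≥0∞) * (1 - u x : ℝ≥0) ∂μ + ∫⁻ y, (φ y : ℝ≥0∞) * (1 - v y : ℝ≥0) ∂ν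
      ≤ entropyBound T (logExpMoment μ fun x => φ x ^ 2) (klDiv ν μ) := by
  have hmoment (γ : Measure E) [IsProbabilityMeasure γ] :
      ∫⁻ x, (φ x : ℝ≥0∞) ^ 2 ∂γ ≤ klDiv γ μ + logExpMoment μ fun x => φ x ^ 2 := by
    have hgibbs := lintegral_le_klDiv_add_logExpMoment (μ := μ) (ν := γ) (f := fun x => φ x ^ 2)
      (hφ.pow_const 2)
    simpa only [ENNReal.coe_pow] using hgibbs
  have hφμ := hmoment μ
  rw [klDiv_self, zero_add] at hφμ
  exact (add_le_add
    (lintegral_mul_le_sqrt_mul_sqrt hφ.coe_nnreal_ennreal (hu.const_sub 1).coe_nnreal_ennreal hφμ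
      (le_min hμ (lintegral_sq_one_sub_le_one u)))
    (lintegral_mul_le_sqrt_mul_sqrt hφ.coe_nnreal_ennreal (hv.const_sub 1).coe_nnreal_ennreal
      (hmoment ν) (le_min hν (lintegral_sq_one_sub_le_one v)))).trans
    (sqrt_mul_add_sqrt_mul_le_entropyBound _ _ (min_le_left _ _) (min_le_right _ _))

lemma isCausalAlong_prod [IsProbabilityMeasure μ] [IsProbabilityMeasure ν] :
    IsCausalAlong ℱ T μ (μ.prod ν) where
  map_fst := by simp
  hasSectionDensity _ _ B _ := ⟨fun _ => ν B, measurable_const, fun A _ => by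
    rw [Measure.prod_prod, setLIntegral_const, mul_comm]⟩

theorem exists_isCausalAlong_setLIntegral_le_entropyBound [StandardBorelSpace E]
    [IsProbabilityMeasure μ] [IsProbabilityMeasure ν] (h0 : ν.trim (ℱ.le 0) = μ.trim (ℱ.le 0))
    (hT : mE ≤ ℱ T) :
    ∃ π : Measure (E × E), IsCausalAlong ℱ T μ π ∧ IsCausalAlong ℱ T ν (π.map Prod.swap) ∧
      ∀ φ : E → ℝ≥0, Measurable φ → ∫⁻ p in {p : E × E | p.1 ≠ p.2}, (φ p.1 + φ p.2 : ℝ≥0∞) ∂π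
        ≤ entropyBound T (logExpMoment μ fun x => φ x ^ 2) (klDiv ν μ) := by
  rcases eq_or_ne (klDiv ν μ) ∞ with htop | hfin
  · refine ⟨μ.prod ν, isCausalAlong_prod, ?_, fun φ _ => ?_⟩
    · rw [Measure.prod_swap]
      exact isCausalAlong_prod
    · have hpos : ENNReal.ofReal (2 * Real.sqrt T + 1) ≠ 0 :=
        (ENNReal.ofReal_pos.2 (by positivity)).ne'
      simp [entropyBound, htop, ENNReal.mul_top, hpos]
  · obtain ⟨r, hr⟩ := exists_isTransitionRatio (klDiv_ne_top_iff.1 hfin).1 h0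
    have hu := hr.isSurvivalProcess_survivalFst
    have hv := hr.isSurvivalProcess_survivalSnd
    obtain ⟨π, hπ, hπ', hcost⟩ := exists_isCausalAlong_of_isSurvivalProcess hu hv
      (fun t _ hA => hr.setLIntegral_survival_eq t hA) hT
    refine ⟨π, hπ, hπ', fun φ hφ => (hcost _ hφ.coe_nnreal_ennreal).trans ?_⟩
    exact lintegral_mul_add_lintegral_mul_le_entropyBound hφ (hu.measurable T) (hv.measurable T)
      (hr.lintegral_sq_one_sub_le hu hr.lintegral_sq_loss_survivalFst_le T)
      (hr.lintegral_sq_one_sub_le hv hr.lintegral_sq_loss_survivalSnd_le T)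

end EntropyBound

section Path

variable {T : ℕ} {X : Fin T → Type u} [∀ i, MeasurableSpace (X i)]

lemma measurable_eval_comap_initSegment {t : ℕ} (i : Fin T) (hi : (i : ℕ) < t) :
    Measurable[.comap (initSegment (X := X) t) inferInstance] fun x : ∀ i, X i => x i :=
  (measurable_pi_apply (⟨i, hi⟩ : {i : Fin T // (i : ℕ) < t})).comp
    (comap_measurable (initSegment (X := X) t))

/-- The information of the first `t` coordinates of a path, as a filtration. -/
def pathFiltration (X : Fin T → Type u) [∀ i, MeasurableSpace (X i)] :
    Filtration ℕ (MeasurableSpace.pi : MeasurableSpace (∀ i, X i)) where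
  seq t := MeasurableSpace.comap (initSegment (X := X) t) inferInstance
  mono' _ t hst := measurable_iff_comap_le.1 <|
    @measurable_pi_lambda _ _ _ (.comap (initSegment (X := X) t) inferInstance) _ _ fun i =>
      measurable_eval_comap_initSegment i.1 (i.2.trans_le hst)
  le' t := (measurable_initSegment t).comap_le

lemma pi_le_pathFiltration : MeasurableSpace.pi ≤ pathFiltration X T :=
  iSup_le fun i => (measurable_eval_comap_initSegment i i.2).comap_le

lemma trim_pathFiltration_zero (μ ν : Measure (∀ i, X i)) [IsProbabilityMeasure μ]
    [IsProbabilityMeasure ν] :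
    ν.trim ((pathFiltration X).le 0) = μ.trim ((pathFiltration X).le 0) := by
  have hempty : IsEmpty {i : Fin T // (i : ℕ) < 0} := ⟨fun i => absurd i.2 (Nat.not_lt_zero _)⟩
  refine @Measure.ext _ (pathFiltration X 0) _ _ fun A hA => ?_
  rw [trim_measurableSet_eq _ hA, trim_measurableSet_eq _ hA]
  obtain ⟨S, -, rfl⟩ := hA
  rcases S.eq_empty_or_nonempty with rfl | hS
  · simp
  · simp [Subsingleton.eq_univ_of_nonempty hS]

lemma isBicausalCoupling_of_isCausalAlong [∀ i, StandardBorelSpace (X i)]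
    {μ ν : Measure (∀ i, X i)} {π : Measure ((∀ i, X i) × (∀ i, X i))} [IsProbabilityMeasure π]
    (h : IsCausalAlong (pathFiltration X) T μ π)
    (h' : IsCausalAlong (pathFiltration X) T ν (π.map Prod.swap)) :
    IsBicausalCoupling π μ ν := by
  have hsnd : π.map Prod.snd = ν := by
    rw [← h'.map_fst, Measure.map_map measurable_fst measurable_swap]
    rfl
  refine ⟨h.map_fst, hsnd, fun t _ ht => ?_, fun t _ ht => ?_⟩
  · refine condIndepFun_of_hasSectionDensity measurable_fst measurable_snd
      (measurable_initSegment t) (measurable_initSegment t) ?_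
    simp only [h.map_fst, Prod.mk.eta, Measure.map_id']
    exact h.hasSectionDensity t ht.le
  · refine condIndepFun_of_hasSectionDensity measurable_snd measurable_fst
      (measurable_initSegment t) (measurable_initSegment t) ?_
    rw [hsnd]
    exact h'.hasSectionDensity t ht.le

end Path

end AdaptedTransport

theorem theorem1p4_general {T : ℕ} {X : Fin T → Type*} [∀ i, MeasurableSpace (X i)]
    [∀ i, StandardBorelSpace (X i)] (μ ν : Measure (∀ i, X i)) [IsProbabilityMeasure μ]
    [IsProbabilityMeasure ν] :
    ∃ π : ProbabilityMeasure ((∀ i, X i) × (∀ i, X i)),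
      AdaptedTransport.IsBicausalCoupling (π : Measure ((∀ i, X i) × (∀ i, X i))) μ ν ∧
      ∀ φ : (∀ i, X i) → ℝ≥0, Measurable φ →
        ∫⁻ p, {p : (∀ i, X i) × (∀ i, X i) | p.1 ≠ p.2}.indicator
            (fun p => (φ p.1 : ℝ≥0∞) + (φ p.2 : ℝ≥0∞)) p ∂(π : Measure ((∀ i, X i) × (∀ i, X i)))
          ≤ ENNReal.ofReal (2 * Real.sqrt T + 1)
            * ((1 + ENNReal.log
                (∫⁻ x, ENNReal.ofReal (Real.exp ((φ x : ℝ) ^ 2)) ∂μ)).toENNReal) ^ (1 / 2 : ℝ)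
            * (2 * klDiv ν μ) ^ (1 / 2 : ℝ) := by
  obtain ⟨π, hπ, hπ', hcost⟩ :=
    AdaptedTransport.exists_isCausalAlong_setLIntegral_le_entropyBound (T := T)
      (AdaptedTransport.trim_pathFiltration_zero μ ν) AdaptedTransport.pi_le_pathFiltration
  have hprob : IsProbabilityMeasure π := by
    have : IsProbabilityMeasure (π.map Prod.fst) := hπ.map_fst ▸ inferInstance
    exact Measure.isProbabilityMeasure_of_map Prod.fst
  have hbc := AdaptedTransport.isBicausalCoupling_of_isCausalAlong hπ hπ'
  refine ⟨⟨π, hprob⟩, hbc, fun φ hφ => ?_⟩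
  have hlog := AdaptedTransport.toENNReal_one_add_log_lintegral_exp (μ := μ) fun x => φ x ^ 2
  simp only [NNReal.coe_pow] at hlog
  rw [hlog, ProbabilityMeasure.coe_mk,
    lintegral_indicator AdaptedTransport.measurableSet_fst_ne_snd]
  exact hcost φ hφ

/-- All quantities live in `[0, ∞]`, with `0 * ∞ = 0`. The argument of the logarithm is at least `1`,
so `1 + log ∫ exp (φ ^ 2) dμ` is an element of `[1, ∞]`, and `toENNReal` only changes its type.
`klDiv ν μ` is the relative entropy `H(ν | μ)`. -/
theorem theorem1p4 {T : ℕ} {X : Fin T → Type*}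
    [∀ i, TopologicalSpace (X i)] [∀ i, PolishSpace (X i)]
    [∀ i, MeasurableSpace (X i)] [∀ i, BorelSpace (X i)]
    (μ ν : Measure (∀ i, X i)) [IsProbabilityMeasure μ] [IsProbabilityMeasure ν]
    (φ : (∀ i, X i) → ℝ≥0) (hφ : Measurable φ) :
    AdaptedTransport.adaptedTV φ μ ν ≤
      ENNReal.ofReal (2 * Real.sqrt T + 1)
        * ((1 + ENNReal.log
            (∫⁻ x, ENNReal.ofReal (Real.exp ((φ x : ℝ) ^ 2)) ∂μ)).toENNReal) ^ (1 / 2 : ℝ)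
        * (2 * klDiv ν μ) ^ (1 / 2 : ℝ) := by
  obtain ⟨π, hπ, hcost⟩ := theorem1p4_general μ ν
  exact (iInf₂_le π hπ).trans (hcost φ hφ)
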